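/- Let $\mathbb F$ be $\mathbb R$ or $\mathbb C$. Let $\mathcal F_0$ be the set of formal power series $g\in\mathbb F[[x]]$ with $g(0)\neq 0$, and let $\mathcal F_1$ be the set of $F\in\mathbb F[[x]]$ with $F(0)=0$ and $F'(0)\ne 0$, which is a group under composition $\circ$ with identity $x$; write $\overline\theta$ for the compositional inverse of $\theta\in\mathcal F_1$. For $g=\sum_{n\ge 0}g_nx^n\in\mathcal F_0$ and $F=\sum_{n\ge1}f_nx^n\in\mathcal F_1$, the Riordan matrix $(g,F)$ is the infinite lower triangular matrix $[a_{ij}]_{i,j\ge 0}$ with $a_{ij}=[x^i]\,g(x)F(x)^j$. Riordan matrices form a group $\mathcal R(\mathbb F)$, the Riordan group, under matrix multiplication, with $(g,F)(h,L)=(g\cdot h(F),\,L(F))$ and identity $(1,x)$. An eigenvector of $A\in\mathcal R(\mathbb F)$ is a nonzero vector $\mathbf h=(h_0,h_1,\dots)^T$ with entries in $\mathbb F$ such that $A\mathbf h=\lambda\mathbf h$ for some $\lambda\in\mathbb F$. It has level $k\geq 0$ if $h_i=0$ for all $i<k$ and $h_k\neq 0$; it is primary if it has level $0$. A full set of eigenvectors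 of $A$ is a set $\{\mathbf h_0,\mathbf h_1,\mathbf h_2,\dots\}$ of eigenvectors of $A$ in which $\mathbf h_k$ has level $k$ for every $k\ge 0$. An element $a$ of $\mathbb F\setminus\{0\}$ (under multiplication), of $\mathcal F_1$ (under composition) or of $\mathcal R(\mathbb F)$ has finite order $n$ if $n$ is the smallest positive integer such that the $n$-th power of $a$ is the identity, and it has infinite order if no such $n$ exists. **Theorem.** Let $A=(g,F)\in\mathcal R(\mathbb F)$, and write $g_0=g(0)$ and $f_1=[x]F$. Then the following statements are equivalent: (a) $A$ has a full set of eigenvectors. (b) $A$ has two linearly independent eigenvectors. (c) $A$ has an eigenvector of level $k$ for some $k>0$, and there exists $\theta\in\mathcal F_1$ such that $(\theta\circ F\circ\overline\theta)(x)=f_1x$. (d) $A$ has a primary eigenvector, and there exists $\theta\in\mathcal F_1$ such that $(\theta\circ F\circ\overline\theta)(x)=f_1x$. (e) There exists a Riordan matrix $(h,\theta)\in\mathcal R(\mathbb F)$ such that $(h,\theta)^{-1}(g,F)(h,\theta)=(g_0,f_1x)$. (f) $A$ has an eigenvector of level $k$ for some $k\geq 0$, and either $F$ has finite compositional order in $\mathcal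 F_1$ or $f_1$ has infinite multiplicative order. (g) Either $f_1$ has infinite multiplicative order in $\mathbb F\setminus\{0\}$, or, with $\widehat g:=\frac1{g_0}g\in\mathcal F_0$, the Riordan matrix $(\widehat g,F)$ has finite order in $\mathcal R(\mathbb F)$, equal to the multiplicative order of $f_1$. -/

import Mathlib

namespace Riordan

open PowerSeries

/-- `DeltaSeries K` is the set of formal power series `F` with `F(0) = 0` and `F'(0) ≠ 0`. -/
@[ext]
structure DeltaSeries (K : Type*) [Field K] where
  series : K⟦X⟧
  constantCoeff_eq_zero : constantCoeff series = 0
  coeff_one_ne_zero : coeff 1 series ≠ 0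

/-- A Riordan matrix `(g, F)`, recorded through the two series that determine it:
`g(0) ≠ 0`, `F(0) = 0`, `F'(0) ≠ 0`. Its entries are given by `RiordanMatrix.toMatrix`. -/
@[ext]
structure RiordanMatrix (K : Type*) [Field K] where
  g : K⟦X⟧
  F : DeltaSeries K
  constantCoeff_ne_zero : constantCoeff g ≠ 0

variable {K : Type*} [Field K]

theorem DeltaSeries.hasSubst (F : DeltaSeries K) : HasSubst F.series :=
  HasSubst.of_constantCoeff_zero' F.constantCoeff_eq_zero

theorem constantCoeff_subst_series (F : DeltaSeries K) (f : K⟦X⟧) :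
    constantCoeff (f.subst F.series : K⟦X⟧) = constantCoeff f := by
  rw [← coeff_zero_eq_constantCoeff_apply, coeff_subst' F.hasSubst, finsum_eq_single _ 0]
  · simp
  · intro d hd
    simp [F.constantCoeff_eq_zero, hd]

theorem coeff_one_subst_series (F G : DeltaSeries K) :
    coeff 1 (F.series.subst G.series : K⟦X⟧) = coeff 1 F.series * coeff 1 G.series := by
  obtain ⟨f, hf⟩ := X_dvd_iff.mpr F.constantCoeff_eq_zero
  rw [hf, subst_mul G.hasSubst, subst_X G.hasSubst, coeff_mul, coeff_mul]
  simp [Finset.Nat.antidiagonal_succ, G.constantCoeff_eq_zero, constantCoeff_subst_series,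
    mul_comm]

namespace DeltaSeries

/-- The coefficient `f₁` of `x` in `F`. -/
noncomputable def f₁ (F : DeltaSeries K) : K := coeff 1 F.series

/-- The linear part `f₁ x` of `F`. -/
noncomputable def linearPart (F : DeltaSeries K) : DeltaSeries K where
  series := C F.f₁ * X
  constantCoeff_eq_zero := by simp
  coeff_one_ne_zero := by simpa [f₁] using F.coeff_one_ne_zero

/-- The product is composition: `F * G` is `F ∘ G`, that is `x ↦ F(G(x))`. -/
noncomputable instance : Mul (DeltaSeries K) where
  mul F G :=
    { series := F.series.subst G.series
      constantCoeff_eq_zero := by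
        rw [constantCoeff_subst_series, F.constantCoeff_eq_zero]
      coeff_one_ne_zero := by
        rw [coeff_one_subst_series]
        exact mul_ne_zero F.coeff_one_ne_zero G.coeff_one_ne_zero }

/-- The unit is the series `x`. -/
noncomputable instance : One (DeltaSeries K) where
  one :=
    { series := X
      constantCoeff_eq_zero := by simp
      coeff_one_ne_zero := by simp }

/-- The compositional inverse. -/
noncomputable instance : Inv (DeltaSeries K) where
  inv F :=
    { series := F.series.substInvOfIsUnit (IsUnit.mk0 _ F.coeff_one_ne_zero)
      constantCoeff_eq_zero := by simp
      coeff_one_ne_zero := by simpa using F.coeff_one_ne_zero }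

theorem mul_series (F G : DeltaSeries K) :
    (F * G).series = F.series.subst G.series := rfl

theorem one_series : (1 : DeltaSeries K).series = X := rfl

theorem inv_mul (F : DeltaSeries K) : F⁻¹ * F = 1 :=
  DeltaSeries.ext (subst_substInvOfIsUnit_left F.series F.constantCoeff_eq_zero _)

theorem mul_assoc' (F G H : DeltaSeries K) : F * G * H = F * (G * H) :=
  DeltaSeries.ext (subst_comp_subst_apply G.hasSubst H.hasSubst F.series)

theorem one_mul' (F : DeltaSeries K) : 1 * F = F :=
  DeltaSeries.ext (subst_X F.hasSubst)

theorem mul_one' (F : DeltaSeries K) : F * 1 = F :=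
  DeltaSeries.ext (X_subst F.series)

/-- The group of such series under composition. -/
noncomputable instance : Group (DeltaSeries K) where
  mul_assoc := mul_assoc'
  one_mul := one_mul'
  mul_one := mul_one'
  inv_mul_cancel := inv_mul

end DeltaSeries

namespace RiordanMatrix

/-- The entries `a_{ij} = [x^i] g(x) F(x)^j`. -/
noncomputable def toMatrix (A : RiordanMatrix K) : Matrix ℕ ℕ K :=
  Matrix.of fun i j => coeff i (A.g * A.F.series ^ j)

theorem toMatrix_apply (A : RiordanMatrix K) (i j : ℕ) :
    A.toMatrix i j = coeff i (A.g * A.F.series ^ j) := rfl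

/-- A Riordan matrix is lower triangular. -/
theorem toMatrix_eq_zero (A : RiordanMatrix K) {i j : ℕ} (h : i < j) : A.toMatrix i j = 0 := by
  obtain ⟨f, hf⟩ := X_dvd_iff.mpr A.F.constantCoeff_eq_zero
  rw [toMatrix_apply, hf, mul_pow, mul_left_comm, coeff_X_pow_mul', if_neg (by omega)]

/-- The matrix determines the two series, so `RiordanMatrix` is the set of Riordan matrices. -/
theorem toMatrix_injective :
    Function.Injective (toMatrix : RiordanMatrix K → Matrix ℕ ℕ K) := by
  intro A B h
  have hg : A.g = B.g := by
    ext i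
    simpa [toMatrix_apply] using congrFun (congrFun h i) 0
  have hgF : A.g * A.F.series = B.g * B.F.series := by
    ext i
    simpa [toMatrix_apply] using congrFun (congrFun h i) 1
  have h0 : B.g ≠ 0 := fun h => B.constantCoeff_ne_zero (by simp [h])
  rw [hg] at hgF
  exact RiordanMatrix.ext hg (DeltaSeries.ext (mul_left_cancel₀ h0 hgF))

/-- The product `A v` of the lower triangular matrix `A` with an infinite column vector `v`.
The entries `a_{ij}` with `j > i` vanish, so row `i` contributes a finite sum. -/
noncomputable def mulVec (A : RiordanMatrix K) (v : ℕ → K) : ℕ → K :=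
  fun i => ∑ j ∈ Finset.range (i + 1), A.toMatrix i j * v j

/-- The product `(g, F) (h, L) = (g · h(F), L(F))`. -/
noncomputable instance : Mul (RiordanMatrix K) where
  mul A B :=
    { g := A.g * B.g.subst A.F.series
      F := B.F * A.F
      constantCoeff_ne_zero := by
        rw [map_mul, constantCoeff_subst_series]
        exact mul_ne_zero A.constantCoeff_ne_zero B.constantCoeff_ne_zero }

/-- The identity matrix `(1, x)`. -/
noncomputable instance : One (RiordanMatrix K) where
  one := { g := 1, F := 1, constantCoeff_ne_zero := by simp }

/-- The inverse `(g, F)⁻¹ = (1 / g(F̄), F̄)`, where `F̄` is the compositional inverse of `F`. -/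
noncomputable instance : Inv (RiordanMatrix K) where
  inv A :=
    { g := (A.g.subst (A.F⁻¹).series)⁻¹
      F := A.F⁻¹
      constantCoeff_ne_zero := by
        rw [constantCoeff_inv, constantCoeff_subst_series]
        exact inv_ne_zero A.constantCoeff_ne_zero }

theorem mul_g (A B : RiordanMatrix K) : (A * B).g = A.g * B.g.subst A.F.series := rfl

theorem mul_F (A B : RiordanMatrix K) : (A * B).F = B.F * A.F := rfl

theorem one_g : (1 : RiordanMatrix K).g = 1 := rfl

theorem one_F : (1 : RiordanMatrix K).F = 1 := rfl

theorem inv_g (A : RiordanMatrix K) : (A⁻¹).g = (A.g.subst (A.F⁻¹).series)⁻¹ := rfl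

theorem inv_F (A : RiordanMatrix K) : (A⁻¹).F = A.F⁻¹ := rfl

theorem subst_one (F : DeltaSeries K) : ((1 : K⟦X⟧).subst F.series : K⟦X⟧) = 1 := by
  rw [← coe_substAlgHom F.hasSubst, map_one]

/-- The Riordan group. -/
noncomputable instance : Group (RiordanMatrix K) where
  mul_assoc A B D := by
    refine RiordanMatrix.ext ?_ ?_
    · rw [mul_g, mul_g, mul_g, mul_g, mul_F, DeltaSeries.mul_series, subst_mul A.F.hasSubst,
        subst_comp_subst_apply B.F.hasSubst A.F.hasSubst, mul_assoc]
    · simp only [mul_F, mul_assoc]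
  one_mul A := by
    refine RiordanMatrix.ext ?_ ?_
    · rw [mul_g, one_g, one_F, DeltaSeries.one_series, one_mul]
      exact X_subst A.g
    · rw [mul_F, one_F, mul_one]
  mul_one A := by
    refine RiordanMatrix.ext ?_ ?_
    · rw [mul_g, one_g, subst_one, mul_one]
    · rw [mul_F, one_F, one_mul]
  inv_mul_cancel A := by
    refine RiordanMatrix.ext ?_ ?_
    · rw [mul_g, inv_g, inv_F, one_g]
      refine PowerSeries.inv_mul_cancel _ ?_
      rw [constantCoeff_subst_series]
      exact A.constantCoeff_ne_zero
    · rw [mul_F, inv_F, one_F, mul_inv_cancel]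

/-- The group law is matrix multiplication. -/
theorem toMatrix_mul (A B : RiordanMatrix K) (i j : ℕ) :
    (A * B).toMatrix i j = ∑ k ∈ Finset.range (i + 1), A.toMatrix i k * B.toMatrix k j := by
  obtain ⟨m, hm⟩ := X_dvd_iff.mpr A.F.constantCoeff_eq_zero
  have hz : ∀ n d : ℕ, n < d → coeff n (A.F.series ^ d) = 0 := by
    intro n d h
    rw [hm, mul_pow, coeff_X_pow_mul', if_neg (by omega)]
  have hs : ∀ n : ℕ, n ≤ i → coeff n ((B.g * B.F.series ^ j).subst A.F.series : K⟦X⟧) =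
      ∑ k ∈ Finset.range (i + 1), coeff k (B.g * B.F.series ^ j) * coeff n (A.F.series ^ k) := by
    intro n hn
    rw [coeff_subst' A.F.hasSubst]
    rw [finsum_eq_sum_of_support_subset (s := Finset.range (i + 1))]
    · simp
    · intro d hd
      by_contra hc
      simp only [Finset.coe_range, Set.mem_Iio, not_lt] at hc
      exact hd (by simp [hz n d (by omega)])
  rw [toMatrix_apply, mul_g, mul_F, DeltaSeries.mul_series, ← subst_pow A.F.hasSubst, mul_assoc,
    ← subst_mul A.F.hasSubst, coeff_mul]
  calc _ = ∑ p ∈ Finset.HasAntidiagonal.antidiagonal i, coeff p.1 A.g * ∑ k ∈ Finset.range (i + 1),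
        coeff k (B.g * B.F.series ^ j) * coeff p.2 (A.F.series ^ k) := by
        refine Finset.sum_congr rfl fun p hp => ?_
        rw [hs p.2 (by rw [Finset.HasAntidiagonal.mem_antidiagonal] at hp; omega)]
    _ = _ := by
        simp only [Finset.mul_sum]
        rw [Finset.sum_comm]
        refine Finset.sum_congr rfl fun k _ => ?_
        rw [toMatrix_apply, toMatrix_apply, coeff_mul i A.g, Finset.sum_mul]
        refine Finset.sum_congr rfl fun p _ => ?_
        ring

/-- The coefficient `g₀ = g(0)`. -/
noncomputable def g₀ (A : RiordanMatrix K) : K := constantCoeff A.g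

/-- The diagonal matrix `(g₀, f₁ x)`. -/
noncomputable def diagonalPart (A : RiordanMatrix K) : RiordanMatrix K where
  g := C A.g₀
  F := A.F.linearPart
  constantCoeff_ne_zero := by simpa [g₀] using A.constantCoeff_ne_zero

/-- The Riordan matrix `(g / g₀, F)`. -/
noncomputable def normalization (A : RiordanMatrix K) : RiordanMatrix K where
  g := C A.g₀⁻¹ * A.g
  F := A.F
  constantCoeff_ne_zero := by
    rw [map_mul, constantCoeff_C]
    exact mul_ne_zero (inv_ne_zero A.constantCoeff_ne_zero) A.constantCoeff_ne_zero

/-- `v` is an eigenvector of `A`. -/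
def IsEigenvector (A : RiordanMatrix K) (v : ℕ → K) : Prop :=
  v ≠ 0 ∧ ∃ μ : K, A.mulVec v = μ • v

/-- `v` is an eigenvector of level `k`: an eigenvector of the form
`(0, …, 0, v_k, v_{k+1}, …)` with `v_k ≠ 0`. -/
def IsEigenvectorOfLevel (A : RiordanMatrix K) (k : ℕ) (v : ℕ → K) : Prop :=
  A.IsEigenvector v ∧ (∀ i < k, v i = 0) ∧ v k ≠ 0

/-- A primary eigenvector is one of level `0`. -/
def IsPrimaryEigenvector (A : RiordanMatrix K) (v : ℕ → K) : Prop :=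
  A.IsEigenvectorOfLevel 0 v

/-- `A` has a full set of eigenvectors `v₀, v₁, v₂, …`: one of each level. -/
def HasFullSetOfEigenvectors (A : RiordanMatrix K) : Prop :=
  ∃ v : ℕ → ℕ → K, ∀ k, A.IsEigenvectorOfLevel k (v k)

end RiordanMatrix

end Riordan

/-!
In terms of generating functions the matrix `(g, F)` acts by `v ↦ g · v(F)`, and an eigenvector of
level `k` has the eigenvalue `g₀ f₁ ^ k`, so everything is a statement about solutions of
`g · v(F) = g₀ f₁ ^ k v`. A matrix `(h, θ)` diagonalizes `A` exactly when `h` is a solution for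
`k = 0` with `h(0) ≠ 0` and `θ` solves Schröder's equation `θ(F) = f₁ θ`
(`conj_eq_diagonalPart_iff`); then `h θ ^ k` is an eigenvector of level `k` for every `k`.
Conversely an eigenvector `u` of any level `k` and a solution `θ` suffice, with `h = u / θ ^ k`
(`exists_conj_of_isEigenvectorOfLevel`). All conditions are compared with diagonalizability.

If `f₁` has infinite order, the diagonal entries `g₀ f₁ ^ i` are distinct and the triangular
eigenvector equations can be solved row by row, for `A` and for `(1, F)`
(`exists_conj_of_not_isOfFinOrder`).

If `f₁` has finite order, averaging replaces the recursion. When `F ^ n = 1`, the sum of the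
`f₁⁻ⁱ Fⁱ` for `i < n` solves Schröder's equation; when the normalization of `A` has finite order,
the sum of its orbit on the series `1` is a primary eigenvector. Finiteness of the order of `F`
comes from two independent eigenvectors: they yield two of different levels, whose quotient `w` has
order `m > 0` and satisfies `w(F) = f₁ ^ m w`. For `f₁ ^ n = 1` the iterate `F ^ n` is then tangent
to the identity and fixes `w`, which in characteristic zero forces `F ^ n = 1`
(`DeltaSeries.eq_one_of_subst_eq`). Finally, a diagonalizing matrix conjugates the normalization of
`A` to `(1, f₁ x)`, whose order is that of `f₁`.
-/

namespace Riordan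

open PowerSeries

variable {K : Type*} [Field K]

/-! ### Substitution and composition -/

theorem C_subst (a : K) (F : DeltaSeries K) : ((C a).subst F.series : K⟦X⟧) = C a := by
  have h : (C a : K⟦X⟧) = a • (1 : K⟦X⟧) := by rw [smul_eq_C_mul, mul_one]
  rw [h, subst_smul F.hasSubst, RiordanMatrix.subst_one]

theorem subst_sum {ι : Type*} (s : Finset ι) (f : ι → K⟦X⟧) (F : DeltaSeries K) :
    ((∑ i ∈ s, f i).subst F.series : K⟦X⟧) = ∑ i ∈ s, (f i).subst F.series := by
  simp only [← coe_substAlgHom F.hasSubst, map_sum]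

/-- A substitution congruent to the identity modulo `X ^ N` does not change any series
modulo `X ^ N`. -/
theorem X_pow_dvd_subst_sub {N : ℕ} (G : DeltaSeries K) (h : X ^ N ∣ G.series - X) (s : K⟦X⟧) :
    X ^ N ∣ (s.subst G.series : K⟦X⟧) - s := by
  rw [X_pow_dvd_iff]
  intro n hn
  have hX : s = (s.subst (1 : DeltaSeries K).series : K⟦X⟧) := (X_subst s).symm
  conv_lhs => rw [map_sub]; arg 2; rw [hX]
  rw [coeff_subst' G.hasSubst, coeff_subst' (1 : DeltaSeries K).hasSubst, sub_eq_zero]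
  refine finsum_congr fun d => ?_
  have hd : X ^ N ∣ G.series ^ d - X ^ d := h.trans (sub_dvd_pow_sub_pow _ _ d)
  have := X_pow_dvd_iff.mp hd n hn
  rw [map_sub, sub_eq_zero] at this
  rw [this, DeltaSeries.one_series]

namespace DeltaSeries

theorem series_ne_zero (F : DeltaSeries K) : F.series ≠ 0 := fun h =>
  F.coeff_one_ne_zero (by simp [h])

theorem f₁_ne_zero (F : DeltaSeries K) : F.f₁ ≠ 0 := F.coeff_one_ne_zero

/-- A delta series is `X` times a series whose constant coefficient is its linear coefficient. -/
theorem exists_eq_X_mul (F : DeltaSeries K) :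
    ∃ t : K⟦X⟧, F.series = X * t ∧ constantCoeff t = F.f₁ := by
  obtain ⟨t, ht⟩ := X_dvd_iff.mpr F.constantCoeff_eq_zero
  refine ⟨t, ht, ?_⟩
  rw [f₁, ht, ← coeff_zero_eq_constantCoeff_apply, ← coeff_succ_X_mul]

theorem f₁_mul (F G : DeltaSeries K) : (F * G).f₁ = F.f₁ * G.f₁ := coeff_one_subst_series F G

theorem f₁_one : (1 : DeltaSeries K).f₁ = 1 := by simp [f₁, one_series]

theorem f₁_pow (F : DeltaSeries K) (n : ℕ) : (F ^ n).f₁ = F.f₁ ^ n := by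
  induction n with
  | zero => simp [f₁_one]
  | succ n ih => rw [pow_succ, f₁_mul, ih, pow_succ]

theorem linearPart_mul_series (F G : DeltaSeries K) :
    (F.linearPart * G).series = C F.f₁ * G.series := by
  rw [mul_series, linearPart, subst_mul G.hasSubst, subst_X G.hasSubst, C_subst]

theorem linearPart_pow_series (F : DeltaSeries K) (n : ℕ) :
    (F.linearPart ^ n).series = C (F.f₁ ^ n) * X := by
  induction n with
  | zero => simp [one_series]
  | succ n ih => rw [pow_succ', linearPart_mul_series, ih, pow_succ', map_mul, mul_assoc]

theorem linearPart_pow_eq_one_iff (F : DeltaSeries K) (n : ℕ) :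
    F.linearPart ^ n = 1 ↔ F.f₁ ^ n = 1 := by
  constructor
  · intro h
    have := congrArg (fun G : DeltaSeries K => coeff 1 G.series) h
    simpa [linearPart_pow_series, one_series] using this
  · intro h
    apply DeltaSeries.ext
    rw [linearPart_pow_series, h, one_series, map_one, one_mul]

/-- Schröder's equation `θ(F(x)) = f₁ θ(x)`: the series form of `θ ∘ F ∘ θ⁻¹ = f₁ x`. -/
theorem conj_eq_linearPart_iff (F θ : DeltaSeries K) :
    θ * F * θ⁻¹ = F.linearPart ↔ θ.series.subst F.series = C F.f₁ * θ.series := by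
  rw [mul_inv_eq_iff_eq_mul, DeltaSeries.ext_iff, linearPart_mul_series, mul_series]

/-- A series of finite compositional order is conjugate to its linear part: if `F ^ n = 1`, the sum
of `f₁⁻ⁱ Fⁱ` over `i < n` solves Schröder's equation. -/
theorem exists_conj_eq_linearPart_of_isOfFinOrder [CharZero K] {F : DeltaSeries K}
    (hF : IsOfFinOrder F) : ∃ θ : DeltaSeries K, θ * F * θ⁻¹ = F.linearPart := by
  obtain ⟨n, hn, hFn⟩ := isOfFinOrder_iff_pow_eq_one.mp hF
  have hf : F.f₁ ^ n = 1 := by rw [← f₁_pow, hFn, f₁_one]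
  let S : ℕ → K⟦X⟧ := fun i => C (F.f₁⁻¹ ^ i) * (F ^ i).series
  have hS : ∀ i, (S i).subst F.series = C F.f₁ * S (i + 1) := by
    intro i
    simp only [S]
    rw [subst_mul F.hasSubst, C_subst, ← mul_series, ← pow_succ, ← mul_assoc, ← map_mul,
      pow_succ' F.f₁⁻¹, mul_inv_cancel_left₀ F.f₁_ne_zero]
  let θ : DeltaSeries K :=
    { series := ∑ i ∈ Finset.range n, S i
      constantCoeff_eq_zero := by
        rw [map_sum]
        refine Finset.sum_eq_zero fun i _ => ?_
        rw [map_mul, (F ^ i).constantCoeff_eq_zero, mul_zero]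
      coeff_one_ne_zero := by
        have : ∀ i, coeff 1 (S i) = 1 := by
          intro i
          have h := f₁_pow F i
          rw [f₁] at h
          rw [coeff_C_mul, h, ← mul_pow, inv_mul_cancel₀ F.f₁_ne_zero, one_pow]
        simpa [this] using hn.ne' }
  refine ⟨θ, (conj_eq_linearPart_iff F θ).mpr ?_⟩
  change ((∑ i ∈ Finset.range n, S i).subst F.series : K⟦X⟧) = C F.f₁ * ∑ i ∈ Finset.range n, S i
  have hshift : ∑ i ∈ Finset.range n, S (i + 1) = ∑ i ∈ Finset.range n, S i := by
    have h := (Finset.sum_range_succ S n).symm.trans (Finset.sum_range_succ' S n)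
    have h0 : S n = S 0 := by simp [S, hFn, hf]
    rw [h0] at h
    exact (add_right_cancel h).symm
  rw [subst_sum, Finset.sum_congr rfl fun i _ => hS i, ← Finset.mul_sum, hshift]

/-- In characteristic zero, a series tangent to the identity that fixes a series of positive
order under substitution is the identity. -/
theorem eq_one_of_subst_eq [CharZero K] {G : DeltaSeries K} (hG : G.f₁ = 1) {m : ℕ} (hm : m ≠ 0)
    {s : K⟦X⟧} (hs : constantCoeff s ≠ 0)
    (h : ((X ^ m * s).subst G.series : K⟦X⟧) = X ^ m * s) : G = 1 := by
  obtain ⟨t, ht, ht1⟩ := G.exists_eq_X_mul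
  rw [hG] at ht1
  have key : t ^ m * s.subst G.series = s := by
    rw [subst_mul G.hasSubst, subst_pow G.hasSubst, subst_X G.hasSubst, ht, mul_pow,
      mul_assoc, ← ht] at h
    exact mul_left_cancel₀ (pow_ne_zero _ X_ne_zero) h
  have hgeom : (t - 1) * ∑ i ∈ Finset.range m, t ^ i = t ^ m - 1 := mul_geom_sum t m
  have hGX : G.series - X = X * (t - 1) := by rw [ht]; ring
  -- Divisibility of `t - 1` by `X ^ p` improves to `X ^ (p + 1)`, because the geometric sum
  -- has constant coefficient `m ≠ 0`.
  have hdvd : ∀ p : ℕ, X ^ p ∣ t - 1 := by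
    intro p
    induction p with
    | zero => simp
    | succ p ih =>
      have h1 : X ^ (p + 1) ∣ (s.subst G.series : K⟦X⟧) - s := by
        apply X_pow_dvd_subst_sub
        rw [hGX, pow_succ']
        exact mul_dvd_mul_left X ih
      have h2 : (s.subst G.series : K⟦X⟧) - s
          = -((t - 1) * ((∑ i ∈ Finset.range m, t ^ i) * s.subst G.series)) := by
        rw [← mul_assoc, hgeom]
        linear_combination key
      rw [h2, dvd_neg] at h1
      have hu : IsUnit ((∑ i ∈ Finset.range m, t ^ i) * s.subst G.series : K⟦X⟧) := by
        rw [isUnit_iff_constantCoeff, map_mul, constantCoeff_subst_series, map_sum]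
        simp [ht1, hs, hm]
      exact (hu.dvd_mul_right).mp h1
  have ht' : t - 1 = 0 := by
    ext p
    exact X_pow_dvd_iff.mp (hdvd (p + 1)) p p.lt_succ_self
  apply DeltaSeries.ext
  rw [one_series, ← sub_eq_zero, hGX, ht', mul_zero]

/-- If `f₁` is a root of unity and `w(F) = f₁ ^ m w` for some `w` of order `m > 0`, then `F` has
finite order. -/
theorem isOfFinOrder_of_subst_eq [CharZero K] {F : DeltaSeries K} (hf : IsOfFinOrder F.f₁)
    {m : ℕ} (hm : m ≠ 0) {s : K⟦X⟧} (hs : constantCoeff s ≠ 0)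
    (h : ((X ^ m * s).subst F.series : K⟦X⟧) = C (F.f₁ ^ m) * (X ^ m * s)) :
    IsOfFinOrder F := by
  obtain ⟨n, hn, hfn⟩ := isOfFinOrder_iff_pow_eq_one.mp hf
  have hiter : ∀ i : ℕ, ((X ^ m * s).subst (F ^ i).series : K⟦X⟧)
      = C ((F.f₁ ^ m) ^ i) * (X ^ m * s) := by
    intro i
    induction i with
    | zero => simp [one_series, X_subst]
    | succ i ih =>
      rw [pow_succ, mul_series, ← subst_comp_subst_apply (F ^ i).hasSubst F.hasSubst, ih,
        subst_mul F.hasSubst, C_subst, h, ← mul_assoc, ← map_mul, ← pow_succ]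
  refine isOfFinOrder_iff_pow_eq_one.mpr ⟨n, hn, eq_one_of_subst_eq ?_ hm hs ?_⟩
  · rw [f₁_pow, hfn]
  · rw [hiter, pow_right_comm, hfn, one_pow, map_one, one_mul]

end DeltaSeries

namespace RiordanMatrix

/-! ### Eigenvectors as power series -/

theorem g₀_ne_zero (A : RiordanMatrix K) : A.g₀ ≠ 0 := A.constantCoeff_ne_zero

/-- The fundamental theorem of Riordan matrices: `(g, F)` sends the generating function `v` to
`g · v(F)`. -/
theorem mk_mulVec (A : RiordanMatrix K) (v : ℕ → K) :
    PowerSeries.mk (A.mulVec v) = A.g * (PowerSeries.mk v).subst A.F.series := by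
  have hz : ∀ n d : ℕ, n < d → coeff n (A.F.series ^ d) = 0 := by
    intro n d h
    obtain ⟨t, ht, -⟩ := A.F.exists_eq_X_mul
    rw [ht, mul_pow, coeff_X_pow_mul', if_neg (by omega)]
  ext i
  have hs : ∀ n ≤ i, coeff n ((PowerSeries.mk v).subst A.F.series : K⟦X⟧) =
      ∑ j ∈ Finset.range (i + 1), v j * coeff n (A.F.series ^ j) := by
    intro n hn
    rw [coeff_subst' A.F.hasSubst,
      finsum_eq_sum_of_support_subset (s := Finset.range (i + 1))]
    · simp
    · intro d hd
      by_contra hc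
      simp only [Finset.coe_range, Set.mem_Iio, not_lt] at hc
      exact hd (by simp [hz n d (by omega)])
  rw [coeff_mk, mulVec, coeff_mul]
  simp only [toMatrix_apply, coeff_mul, Finset.sum_mul]
  rw [Finset.sum_comm]
  refine Finset.sum_congr rfl fun p hp => ?_
  rw [hs p.2 (by rw [Finset.HasAntidiagonal.mem_antidiagonal] at hp; omega), Finset.mul_sum]
  exact Finset.sum_congr rfl fun j _ => by ring

theorem toMatrix_self (A : RiordanMatrix K) (i : ℕ) : A.toMatrix i i = A.g₀ * A.F.f₁ ^ i := by
  obtain ⟨t, ht, ht1⟩ := A.F.exists_eq_X_mul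
  have h := coeff_X_pow_mul (A.g * t ^ i) i 0
  rw [zero_add] at h
  rw [toMatrix_apply, ht, mul_pow, mul_left_comm, h, coeff_zero_eq_constantCoeff_apply, map_mul,
    map_pow, ht1, g₀]

/-- `w` satisfies the eigenvector equation of level `k` for `A`, whose eigenvalue is the `k`-th
diagonal entry `g₀ f₁ ^ k`. -/
def EigenEq (A : RiordanMatrix K) (k : ℕ) (w : K⟦X⟧) : Prop :=
  A.g * w.subst A.F.series = C (A.g₀ * A.F.f₁ ^ k) * w

theorem EigenEq.mulVec_eq {A : RiordanMatrix K} {k : ℕ} {w : K⟦X⟧} (h : A.EigenEq k w) :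
    A.mulVec (fun i => coeff i w) = (A.g₀ * A.F.f₁ ^ k) • fun i => coeff i w := by
  have hw : PowerSeries.mk (fun i => coeff i w) = w := by ext; simp
  have h1 := A.mk_mulVec fun i => coeff i w
  rw [hw, h] at h1
  funext i
  simpa only [coeff_mk, coeff_C_mul, Pi.smul_apply, smul_eq_mul] using congrArg (coeff i) h1

theorem exists_eq_X_pow_mul {v : ℕ → K} {k : ℕ} (h0 : ∀ i < k, v i = 0) (hk : v k ≠ 0) :
    ∃ s : K⟦X⟧, constantCoeff s ≠ 0 ∧ PowerSeries.mk v = X ^ k * s := by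
  obtain ⟨s, hs⟩ : X ^ k ∣ PowerSeries.mk v :=
    X_pow_dvd_iff.mpr fun i hi => by simpa using h0 i hi
  refine ⟨s, ?_, hs⟩
  have h := coeff_X_pow_mul s k 0
  rw [zero_add, ← hs, coeff_mk] at h
  rwa [← coeff_zero_eq_constantCoeff_apply, ← h]

/-- An eigenvector of level `k` has a generating function `X ^ k · s` with `s(0) ≠ 0`, and its
eigenvalue is forced to be `g₀ f₁ ^ k`. -/
theorem IsEigenvectorOfLevel.exists_series {A : RiordanMatrix K} {k : ℕ} {v : ℕ → K}
    (h : A.IsEigenvectorOfLevel k v) :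
    ∃ s : K⟦X⟧, constantCoeff s ≠ 0 ∧ PowerSeries.mk v = X ^ k * s ∧ A.EigenEq k (X ^ k * s) := by
  obtain ⟨⟨-, μ, hμ⟩, h0, hk⟩ := h
  obtain ⟨s, hs, hvs⟩ := exists_eq_X_pow_mul h0 hk
  refine ⟨s, hs, hvs, ?_⟩
  have hμk : μ = A.g₀ * A.F.f₁ ^ k := by
    have h1 := congrFun hμ k
    rw [mulVec, Finset.sum_range_succ, Finset.sum_eq_zero fun j hj => by
      rw [h0 j (Finset.mem_range.mp hj), mul_zero], zero_add, toMatrix_self] at h1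
    exact (mul_right_cancel₀ hk h1).symm
  have h2 := A.mk_mulVec v
  rw [hμ, hvs] at h2
  rw [EigenEq, ← h2, ← hμk, ← hvs]
  ext i
  simp

theorem EigenEq.isEigenvectorOfLevel {A : RiordanMatrix K} {k : ℕ} {s : K⟦X⟧}
    (hs : constantCoeff s ≠ 0) (h : A.EigenEq k (X ^ k * s)) :
    A.IsEigenvectorOfLevel k fun i => coeff i (X ^ k * s) := by
  have hk : coeff k (X ^ k * s) ≠ 0 := by
    have h := coeff_X_pow_mul s k 0
    rw [zero_add] at h
    rwa [h, coeff_zero_eq_constantCoeff_apply]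
  refine ⟨⟨fun hz => hk (congrFun hz k), _, h.mulVec_eq⟩, fun i hi => ?_, hk⟩
  exact (coeff_X_pow_mul' s k i).trans (if_neg (by omega))

theorem IsEigenvector.exists_level {A : RiordanMatrix K} {v : ℕ → K} (h : A.IsEigenvector v) :
    ∃ k, A.IsEigenvectorOfLevel k v := by
  classical
  have hex : ∃ i, v i ≠ 0 := Function.ne_iff.mp h.1
  exact ⟨Nat.find hex, h, fun i hi => not_not.mp (Nat.find_min hex hi), Nat.find_spec hex⟩

/-! ### The triangular recursion -/

/-- The solution of the eigenvector equation of a lower triangular matrix `a` for the eigenvalue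
`a k k` that starts with `1` at position `k`, computed row by row. Rows `i > k` with
`a i i = a k k` get the junk value `0`. -/
noncomputable def triangularEigenvector (a : Matrix ℕ ℕ K) (k : ℕ) : ℕ → K
  | i => if i < k then 0 else if i = k then 1 else
      (a k k - a i i)⁻¹ * ∑ j : Fin i, a i j * triangularEigenvector a k j

theorem isEigenvectorOfLevel_triangularEigenvector {A : RiordanMatrix K}
    (hf : ¬ IsOfFinOrder A.F.f₁) (k : ℕ) :
    A.IsEigenvectorOfLevel k (triangularEigenvector A.toMatrix k) := by
  set v := triangularEigenvector A.toMatrix k with hv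
  have h0 : ∀ i < k, v i = 0 := fun i hi => by
    rw [hv, triangularEigenvector, if_pos hi]
  have hk : v k = 1 := by
    rw [hv, triangularEigenvector, if_neg (lt_irrefl k), if_pos rfl]
  have hkne : v k ≠ 0 := by rw [hk]; exact one_ne_zero
  refine ⟨⟨fun hz => hkne (congrFun hz k), A.toMatrix k k, ?_⟩, h0, hkne⟩
  funext i
  rw [Pi.smul_apply, smul_eq_mul, mulVec, Finset.sum_range_succ]
  rcases lt_trichotomy i k with hi | rfl | hi
  · rw [h0 i hi, Finset.sum_eq_zero fun j hj => by
      rw [h0 j ((Finset.mem_range.mp hj).trans hi), mul_zero]]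
    simp
  · rw [Finset.sum_eq_zero fun j hj => by rw [h0 j (Finset.mem_range.mp hj), mul_zero], zero_add]
  · have hne : A.toMatrix k k - A.toMatrix i i ≠ 0 := by
      rw [toMatrix_self, toMatrix_self, ← mul_sub]
      refine mul_ne_zero A.g₀_ne_zero (sub_ne_zero.mpr fun h => hf ?_)
      refine isOfFinOrder_iff_pow_eq_one.mpr ⟨i - k, by omega, ?_⟩
      have h1 : A.F.f₁ ^ k * A.F.f₁ ^ (i - k) = A.F.f₁ ^ k * 1 := by
        rw [← pow_add, mul_one, Nat.add_sub_cancel' hi.le, h]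
      exact mul_left_cancel₀ (pow_ne_zero _ A.F.f₁_ne_zero) h1
    have hrec : (A.toMatrix k k - A.toMatrix i i) * v i
        = ∑ j ∈ Finset.range i, A.toMatrix i j * v j := by
      rw [hv, triangularEigenvector, if_neg hi.not_gt, if_neg hi.ne',
        mul_inv_cancel_left₀ hne, Fin.sum_univ_eq_sum_range
          fun j => A.toMatrix i j * triangularEigenvector A.toMatrix k j]
    rw [← hrec]
    ring

/-! ### Diagonalization -/

/-- `A` is diagonalized in the Riordan group by `(h, θ)` exactly when `h` is a primary eigenseries
and `θ` solves Schröder's equation. -/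
theorem conj_eq_diagonalPart_iff (A B : RiordanMatrix K) :
    B⁻¹ * A * B = A.diagonalPart ↔
      A.EigenEq 0 B.g ∧ B.F.series.subst A.F.series = C A.F.f₁ * B.F.series := by
  rw [mul_assoc, inv_mul_eq_iff_eq_mul, RiordanMatrix.ext_iff, mul_g, mul_g, mul_F, mul_F,
    DeltaSeries.ext_iff, DeltaSeries.mul_series, diagonalPart, DeltaSeries.linearPart_mul_series,
    C_subst, EigenEq, pow_zero, mul_one, mul_comm B.g]

/-- If `A` is diagonalized by `(h, θ)`, then `h θ ^ k` is an eigenseries of level `k`. -/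
theorem hasFullSetOfEigenvectors_of_conj {A B : RiordanMatrix K}
    (h : B⁻¹ * A * B = A.diagonalPart) : A.HasFullSetOfEigenvectors := by
  obtain ⟨hg, hF⟩ := (conj_eq_diagonalPart_iff A B).mp h
  obtain ⟨t, ht, ht1⟩ := B.F.exists_eq_X_mul
  suffices H : ∀ k, ∃ v, A.IsEigenvectorOfLevel k v from ⟨_, fun k => (H k).choose_spec⟩
  intro k
  refine ⟨_, EigenEq.isEigenvectorOfLevel (s := t ^ k * B.g) ?_ ?_⟩
  · rw [map_mul, map_pow, ht1]
    exact mul_ne_zero (pow_ne_zero _ B.F.f₁_ne_zero) B.constantCoeff_ne_zero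
  · rw [← mul_assoc, ← mul_pow, ← ht, EigenEq, subst_mul A.F.hasSubst, subst_pow A.F.hasSubst, hF,
      mul_left_comm, hg, pow_zero, mul_one, mul_pow, map_mul, map_pow]
    ring

/-- An eigenvector of any level `k`, divided by `θ ^ k`, becomes primary; together with `θ` it
diagonalizes `A`. -/
theorem exists_conj_of_isEigenvectorOfLevel {A : RiordanMatrix K} {k : ℕ} {v : ℕ → K}
    (hv : A.IsEigenvectorOfLevel k v) {θ : DeltaSeries K} (hθ : θ * A.F * θ⁻¹ = A.F.linearPart) :
    ∃ B : RiordanMatrix K, B⁻¹ * A * B = A.diagonalPart := by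
  rw [DeltaSeries.conj_eq_linearPart_iff] at hθ
  obtain ⟨s, hs, -, hu⟩ := hv.exists_series
  obtain ⟨t, ht, ht1⟩ := θ.exists_eq_X_mul
  have htk : constantCoeff (t ^ k) ≠ 0 := by
    rw [map_pow, ht1]; exact pow_ne_zero _ θ.f₁_ne_zero
  have hus : s * (t ^ k)⁻¹ * θ.series ^ k = X ^ k * s := by
    rw [ht, mul_pow]
    linear_combination X ^ k * s * PowerSeries.inv_mul_cancel _ htk
  refine ⟨⟨s * (t ^ k)⁻¹, θ, ?_⟩, (conj_eq_diagonalPart_iff _ _).mpr ⟨?_, hθ⟩⟩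
  · rw [map_mul, constantCoeff_inv]
    exact mul_ne_zero hs (inv_ne_zero htk)
  · rw [← hus, EigenEq, subst_mul A.F.hasSubst, subst_pow A.F.hasSubst, hθ, mul_pow,
      ← map_pow] at hu
    have hne : C (A.F.f₁ ^ k) * θ.series ^ k ≠ 0 :=
      mul_ne_zero (by simpa using pow_ne_zero k A.F.f₁_ne_zero) (pow_ne_zero _ θ.series_ne_zero)
    refine mul_right_cancel₀ hne ?_
    rw [mul_assoc, hu, pow_zero, mul_one, map_mul]
    ring

theorem exists_conj_of_not_isOfFinOrder {A : RiordanMatrix K} (hf : ¬ IsOfFinOrder A.F.f₁) :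
    ∃ B : RiordanMatrix K, B⁻¹ * A * B = A.diagonalPart := by
  -- A level-one eigenvector of `(1, F)` is a solution of Schröder's equation.
  let A₁ : RiordanMatrix K := ⟨1, A.F, by simp⟩
  obtain ⟨s, hs, -, hu⟩ :=
    (isEigenvectorOfLevel_triangularEigenvector (A := A₁) hf 1).exists_series
  let θ : DeltaSeries K := ⟨X * s, by simp, by simpa [coeff_succ_X_mul] using hs⟩
  refine exists_conj_of_isEigenvectorOfLevel
    (isEigenvectorOfLevel_triangularEigenvector hf 0) (θ := θ) ?_
  rw [DeltaSeries.conj_eq_linearPart_iff]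
  change ((X * s).subst A.F.series : K⟦X⟧) = C A.F.f₁ * (X * s)
  simpa [EigenEq, A₁, g₀] using hu

/-- Two eigenvectors of different levels: the quotient of their generating functions satisfies
`w(F) = f₁ ^ m w` with `m > 0`, so that `F` has finite order when `f₁` has. -/
theorem isOfFinOrder_F_of_levels_lt [CharZero K] {A : RiordanMatrix K} (hf : IsOfFinOrder A.F.f₁)
    {j k : ℕ} (hjk : j < k) {u v : ℕ → K} (hu : A.IsEigenvectorOfLevel j u)
    (hv : A.IsEigenvectorOfLevel k v) : IsOfFinOrder A.F := by
  obtain ⟨s, hs, -, hu⟩ := hu.exists_series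
  obtain ⟨r, hr, -, hv⟩ := hv.exists_series
  obtain ⟨m, rfl⟩ := Nat.exists_eq_add_of_lt hjk
  have hw : constantCoeff (r * s⁻¹) ≠ 0 := by
    rw [map_mul, constantCoeff_inv]
    exact mul_ne_zero hr (inv_ne_zero hs)
  refine DeltaSeries.isOfFinOrder_of_subst_eq hf (m := m + 1) m.succ_ne_zero hw ?_
  have hfac : X ^ (j + m + 1) * r = X ^ j * s * (X ^ (m + 1) * (r * s⁻¹)) := by
    linear_combination (-(X ^ (j + m + 1) * r)) * PowerSeries.mul_inv_cancel s hs
  rw [hfac, EigenEq, subst_mul A.F.hasSubst, ← mul_assoc A.g, hu] at hv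
  have hne : C (A.g₀ * A.F.f₁ ^ j) * (X ^ j * s) ≠ 0 := by
    refine mul_ne_zero ?_ (mul_ne_zero (pow_ne_zero _ X_ne_zero) fun h => hs (by simp [h]))
    simpa using ⟨A.g₀_ne_zero, fun h => absurd h A.F.f₁_ne_zero⟩
  refine mul_left_cancel₀ hne (hv.trans ?_)
  rw [add_assoc, pow_add, ← mul_assoc A.g₀, map_mul _ (A.g₀ * _)]
  ring

/-- The span of two linearly independent eigenvectors contains eigenvectors of two different
levels: if both have the same level, they share the eigenvalue, and a combination of them has a higher level. -/
theorem exists_levels_lt {A : RiordanMatrix K} {u v : ℕ → K} (hu : A.IsEigenvector u)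
    (hv : A.IsEigenvector v) (hli : LinearIndependent K ![u, v]) :
    ∃ j k, j < k ∧ (∃ u', A.IsEigenvectorOfLevel j u') ∧ ∃ v', A.IsEigenvectorOfLevel k v' := by
  obtain ⟨j, hj⟩ := hu.exists_level
  obtain ⟨k, hk⟩ := hv.exists_level
  rcases lt_trichotomy j k with h | rfl | h
  · exact ⟨j, k, h, ⟨u, hj⟩, v, hk⟩
  · obtain ⟨s, -, hus, hs⟩ := hj.exists_series
    obtain ⟨r, -, hvr, hr⟩ := hk.exists_series
    set w : ℕ → K := v j • u - u j • v with hw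
    have hmk : PowerSeries.mk w = C (v j) * (X ^ j * s) - C (u j) * (X ^ j * r) := by
      rw [← hus, ← hvr]; ext i; simp [hw]
    have hE : A.EigenEq j (PowerSeries.mk w) := by
      rw [EigenEq] at hs hr ⊢
      rw [hmk, subst_sub A.F.hasSubst, subst_mul A.F.hasSubst, subst_mul A.F.hasSubst (C (u j)),
        C_subst, C_subst]
      linear_combination C (v j) * hs - C (u j) * hr
    have hwne : w ≠ 0 := fun h0 => by
      have := LinearIndependent.pair_iff.mp hli (v j) (-u j)
        (by rw [neg_smul, ← sub_eq_add_neg, ← hw, h0])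
      exact hk.2.2 this.1
    have hwE : A.IsEigenvector w := ⟨hwne, _, by simpa using hE.mulVec_eq⟩
    obtain ⟨l, hl⟩ := hwE.exists_level
    refine ⟨j, l, ?_, ⟨u, hj⟩, w, hl⟩
    by_contra hlj
    apply hl.2.2
    rcases (not_lt.mp hlj).lt_or_eq with h | rfl
    · simp [hw, hj.2.1 l h, hk.2.1 l h]
    · simp [hw, mul_comm]
  · exact ⟨k, j, h, ⟨v, hk⟩, u, hj⟩

/-! ### Finite order of the normalization -/

theorem normalization_pow_F (A : RiordanMatrix K) (n : ℕ) : (A.normalization ^ n).F = A.F ^ n := by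
  induction n with
  | zero => rfl
  | succ n ih => rw [pow_succ, mul_F, ih, pow_succ']; rfl

/-- If the normalization has finite order `n`, the sum of the orbit of the series `1` under it is
fixed by it, and is a primary eigenseries of `A`. -/
theorem exists_isPrimaryEigenvector_of_isOfFinOrder [CharZero K] {A : RiordanMatrix K}
    (h : IsOfFinOrder A.normalization) : ∃ v, A.IsPrimaryEigenvector v := by
  obtain ⟨n, hn, hAn⟩ := isOfFinOrder_iff_pow_eq_one.mp h
  let S : ℕ → K⟦X⟧ := fun i => (A.normalization ^ i).g
  have hS : ∀ i, A.normalization.g * (S i).subst A.F.series = S (i + 1) := fun i => by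
    simp only [S]
    rw [pow_succ', mul_g]; rfl
  have hS1 : ∀ i, constantCoeff (S i) = 1 := by
    intro i
    induction i with
    | zero => simp [S, one_g]
    | succ i ih =>
      rw [← hS, map_mul, constantCoeff_subst_series, ih, normalization, map_mul, constantCoeff_C]
      rw [mul_one]
      exact inv_mul_cancel₀ A.g₀_ne_zero
  have hshift : ∑ i ∈ Finset.range n, S (i + 1) = ∑ i ∈ Finset.range n, S i := by
    have h := (Finset.sum_range_succ S n).symm.trans (Finset.sum_range_succ' S n)
    have h0 : S n = S 0 := by simp [S, hAn]
    rw [h0] at h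
    exact (add_right_cancel h).symm
  refine ⟨_, EigenEq.isEigenvectorOfLevel (k := 0) (s := ∑ i ∈ Finset.range n, S i) ?_ ?_⟩
  · simpa [hS1] using hn.ne'
  · have hfix : A.normalization.g * (∑ i ∈ Finset.range n, S i).subst A.F.series
        = ∑ i ∈ Finset.range n, S i := by
      rw [subst_sum, Finset.mul_sum, Finset.sum_congr rfl fun i _ => hS i, hshift]
    have hg : A.g = C A.g₀ * A.normalization.g := by
      rw [normalization, ← mul_assoc, ← map_mul, mul_inv_cancel₀ A.g₀_ne_zero, map_one, one_mul]
    rw [EigenEq, pow_zero, one_mul, pow_zero, mul_one, hg, mul_assoc, hfix]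

/-- A matrix that diagonalizes `A` conjugates its normalization to `(1, f₁ x)`, which has the same
order as `f₁`. -/
theorem normalization_pow_eq_one_iff {A B : RiordanMatrix K} (h : B⁻¹ * A * B = A.diagonalPart)
    (n : ℕ) : A.normalization ^ n = 1 ↔ A.F.f₁ ^ n = 1 := by
  obtain ⟨hg, hF⟩ := (conj_eq_diagonalPart_iff A B).mp h
  constructor
  · intro h1
    rw [← DeltaSeries.f₁_pow, ← normalization_pow_F, h1, one_F, DeltaSeries.f₁_one]
  · intro h1
    let D : RiordanMatrix K := ⟨1, A.F.linearPart, by simp⟩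
    have hconj : B⁻¹ * A.normalization * B = D := by
      rw [mul_assoc, inv_mul_eq_iff_eq_mul]
      refine RiordanMatrix.ext ?_ (DeltaSeries.ext ?_)
      · rw [EigenEq, pow_zero, mul_one] at hg
        rw [mul_g, mul_g, subst_one, mul_one, normalization, mul_assoc, hg, ← mul_assoc,
          ← map_mul, inv_mul_cancel₀ A.g₀_ne_zero, map_one, one_mul]
      · rw [mul_F, mul_F, DeltaSeries.linearPart_mul_series]
        exact hF
    have hD : D ^ n = 1 := by
      have hpow : ∀ i, D ^ i = ⟨1, A.F.linearPart ^ i, by simp⟩ := by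
        intro i
        induction i with
        | zero => rfl
        | succ i ih =>
          rw [pow_succ', ih]
          refine RiordanMatrix.ext ?_ ?_
          · rw [mul_g, subst_one, mul_one]
          · rw [mul_F, pow_succ]
      rw [hpow]
      exact RiordanMatrix.ext rfl ((A.F.linearPart_pow_eq_one_iff n).mpr h1)
    have h2 : B⁻¹ * A.normalization ^ n * B = 1 := by
      have := conj_pow (a := B⁻¹) (b := A.normalization) (i := n)
      rw [inv_inv, hconj, hD] at this
      exact this.symm
    rwa [mul_assoc, inv_mul_eq_iff_eq_mul, mul_one, mul_eq_right] at h2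

end RiordanMatrix

end Riordan

/-! ### The equivalence -/

theorem mainTheorem1 {𝕜 : Type*} [RCLike 𝕜] (A : Riordan.RiordanMatrix 𝕜) :
    List.TFAE [
      -- (a)
      A.HasFullSetOfEigenvectors,
      -- (b)
      ∃ u v : ℕ → 𝕜, A.IsEigenvector u ∧ A.IsEigenvector v ∧ LinearIndependent 𝕜 ![u, v],
      -- (c)
      (∃ k > 0, ∃ v, A.IsEigenvectorOfLevel k v) ∧
        ∃ θ : Riordan.DeltaSeries 𝕜, θ * A.F * θ⁻¹ = A.F.linearPart,
      -- (d)
      (∃ v, A.IsPrimaryEigenvector v) ∧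
        ∃ θ : Riordan.DeltaSeries 𝕜, θ * A.F * θ⁻¹ = A.F.linearPart,
      -- (e)
      ∃ B : Riordan.RiordanMatrix 𝕜, B⁻¹ * A * B = A.diagonalPart,
      -- (f)
      (∃ k, ∃ v, A.IsEigenvectorOfLevel k v) ∧ (IsOfFinOrder A.F ∨ ¬ IsOfFinOrder A.F.f₁),
      -- (g)
      ¬ IsOfFinOrder A.F.f₁ ∨
        (IsOfFinOrder A.normalization ∧ orderOf A.normalization = orderOf A.F.f₁)] := by
  tfae_have 5 → 1 := fun ⟨_, h⟩ => Riordan.RiordanMatrix.hasFullSetOfEigenvectors_of_conj h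
  tfae_have 1 → 2 := by
    rintro ⟨v, hv⟩
    refine ⟨v 0, v 1, (hv 0).1, (hv 1).1, LinearIndependent.pair_iff.mpr fun a b hab => ?_⟩
    have ha : a = 0 := by
      have h := congrFun hab 0
      simpa [(hv 1).2.1 0 one_pos, (hv 0).2.2] using h
    subst ha
    have h := congrFun hab 1
    exact ⟨rfl, by simpa [(hv 1).2.2] using h⟩
  tfae_have 2 → 5 := by
    rintro ⟨u, v, hu, hv, hli⟩
    by_cases hf : IsOfFinOrder A.F.f₁
    · obtain ⟨j, k, hjk, ⟨u', hu'⟩, v', hv'⟩ :=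
        Riordan.RiordanMatrix.exists_levels_lt hu hv hli
      obtain ⟨θ, hθ⟩ := Riordan.DeltaSeries.exists_conj_eq_linearPart_of_isOfFinOrder
        (Riordan.RiordanMatrix.isOfFinOrder_F_of_levels_lt hf hjk hu' hv')
      exact Riordan.RiordanMatrix.exists_conj_of_isEigenvectorOfLevel hu' hθ
    · exact Riordan.RiordanMatrix.exists_conj_of_not_isOfFinOrder hf
  have hθ : (∃ B : Riordan.RiordanMatrix 𝕜, B⁻¹ * A * B = A.diagonalPart) →
      ∃ θ : Riordan.DeltaSeries 𝕜, θ * A.F * θ⁻¹ = A.F.linearPart := fun ⟨B, h⟩ =>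
    ⟨B.F, (Riordan.DeltaSeries.conj_eq_linearPart_iff _ _).mpr
      ((Riordan.RiordanMatrix.conj_eq_diagonalPart_iff A B).mp h).2⟩
  tfae_have 5 → 3 := fun h => by
    obtain ⟨v, hv⟩ := tfae_5_to_1 h
    exact ⟨⟨1, one_pos, v 1, hv 1⟩, hθ h⟩
  tfae_have 3 → 5 := fun ⟨⟨_, _, _, hv⟩, _, h⟩ =>
    Riordan.RiordanMatrix.exists_conj_of_isEigenvectorOfLevel hv h
  tfae_have 5 → 4 := fun h => by
    obtain ⟨v, hv⟩ := tfae_5_to_1 h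
    exact ⟨⟨v 0, hv 0⟩, hθ h⟩
  tfae_have 4 → 5 := fun ⟨⟨_, hv⟩, _, h⟩ =>
    Riordan.RiordanMatrix.exists_conj_of_isEigenvectorOfLevel hv h
  tfae_have 5 → 7 := by
    rintro ⟨B, h⟩
    by_cases hf : IsOfFinOrder A.F.f₁
    · have hiff := Riordan.RiordanMatrix.normalization_pow_eq_one_iff h
      refine Or.inr ⟨?_, orderOf_eq_orderOf_iff.mpr hiff⟩
      obtain ⟨n, hn, hfn⟩ := isOfFinOrder_iff_pow_eq_one.mp hf
      exact isOfFinOrder_iff_pow_eq_one.mpr ⟨n, hn, (hiff n).mpr hfn⟩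
    · exact Or.inl hf
  -- Powers of the normalization have the powers of `F` as second component.
  have hF : IsOfFinOrder A.normalization → IsOfFinOrder A.F := fun h => by
    obtain ⟨n, hn, hAn⟩ := isOfFinOrder_iff_pow_eq_one.mp h
    refine isOfFinOrder_iff_pow_eq_one.mpr ⟨n, hn, ?_⟩
    rw [← Riordan.RiordanMatrix.normalization_pow_F, hAn, Riordan.RiordanMatrix.one_F]
  tfae_have 5 → 6 := fun h => by
    obtain ⟨v, hv⟩ := tfae_5_to_1 h
    exact ⟨⟨0, v 0, hv 0⟩, (tfae_5_to_7 h).symm.imp_left fun h => hF h.1⟩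
  tfae_have 6 → 5 := by
    rintro ⟨⟨k, v, hv⟩, h | h⟩
    · obtain ⟨θ, hθ⟩ := Riordan.DeltaSeries.exists_conj_eq_linearPart_of_isOfFinOrder h
      exact Riordan.RiordanMatrix.exists_conj_of_isEigenvectorOfLevel hv hθ
    · exact Riordan.RiordanMatrix.exists_conj_of_not_isOfFinOrder h
  tfae_have 7 → 5 := by
    rintro (h | ⟨h, -⟩)
    · exact Riordan.RiordanMatrix.exists_conj_of_not_isOfFinOrder h
    · obtain ⟨v, hv⟩ :=
        Riordan.RiordanMatrix.exists_isPrimaryEigenvector_of_isOfFinOrder h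
      obtain ⟨θ, hθ⟩ := Riordan.DeltaSeries.exists_conj_eq_linearPart_of_isOfFinOrder (hF h)
      exact Riordan.RiordanMatrix.exists_conj_of_isEigenvectorOfLevel hv hθ
  tfae_finish
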